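/- Let $M$ be a smooth $m$-dimensional manifold, Hausdorff and second countable, possibly with boundary (without corners). Let $k\in\mathbb N$ and $r\in\mathbb N\cup\{\infty\}$, and let $E^r=\mathcal C^r(M,\mathbb R^k)$ carry the weak Whitney topology, i.e. the topology defined by the seminorms $$\|f\|_{Q,s}=\sup\{|\partial_\alpha(f\circ Q)(x)| : \alpha\in\mathbb N^m,\ |\alpha|\le s,\ x\in\operatorname{int}(D)\},$$ where $Q\colon D\hookrightarrow M$ ranges over the smooth embeddings of compact sets $D\subset\mathbb R^m$ and $s$ over the natural numbers $s\le r$. Let $(E^r)^*$ be the space of continuous linear functionals $T\colon E^r\to\mathbb R$, with the weak-$*$ topology (pointwise convergence on $E^r$). Let $\mathbb D^m\subset\mathbb R^m$ be the closed unit disk and let $\mathcal M(\mathbb D^m)$ be the set of finite signed Borel measures on it. 1. Let $\mathcal M^r_{loc}$ be the set of all $T\in(E^r)^*$ of the form $$T(f)=\int_{\mathbb D^m}\partial_\alpha(f^j\circ Q)\,d\mu ,$$ for some smooth embedding $Q\colon\mathbb D^m\hookrightarrow M$, some multi-index $\alpha\in\mathbb N^m$ with $|\alpha|\le r$, some $j\in\{1,\dots,k\}$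 and some $\mu\in\mathcal M(\mathbb D^m)$ (at boundary points of $\mathbb D^m$ the derivatives are those up to the boundary). Then $(E^r)^*=\operatorname{span}\mathcal M^r_{loc}$. 2. For all $p\in M$ and $j\in\{1,\dots,k\}$ the point evaluation $\delta_p^j\colon f\mapsto f^j(p)$ belongs to $(E^r)^*$, and the linear span of $\delta_M=\{\delta_p^j : p\in M,\ 1\le j\le k\}$ is dense in $(E^r)^*$ in the weak-$*$ topology: $(E^r)^*=\overline{\operatorname{span}\,\delta_M}$. -/

import Mathlib

open scoped Manifold ContDiff

noncomputable section

/-- The space `ℝⁿ` with its Euclidean norm. -/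
abbrev Euc (n : ℕ) : Type := EuclideanSpace ℝ (Fin n)

/-- `I` is a model for manifolds of dimension `m`, possibly with boundary (but without corners): its
range is `ℝᵐ` or a half space `{x | 0 ≤ xᵢ}`. Both `𝓡 m` and `𝓡∂ m` are of this kind. -/
def IsBoundaryModel {m : ℕ} {H : Type*} [TopologicalSpace H]
    (I : ModelWithCorners ℝ (Euc m) H) : Prop :=
  Set.range I = Set.univ ∨ ∃ i : Fin m, Set.range I = {x : Euc m | 0 ≤ x i}

/-- The constant vectors along which one differentiates to obtain `∂_α`: the basis vector `eᵢ`
occurs `αᵢ` times. -/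
def multiIndexDirections {m : ℕ} (α : Fin m → ℕ) : Fin (∑ i, α i) → Euc m :=
  fun l => EuclideanSpace.single (finSigmaFinEquiv.symm l).1 1

/-- The partial derivative `∂_α g (x)` of order `|α| = ∑ᵢ αᵢ` of a function `g` on the set `D`. At
interior points of `D` this is the usual derivative, at the boundary points of a closed ball it is
the derivative of `g` up to the boundary. -/
def partialDerivOn {m : ℕ} {F : Type*} [NormedAddCommGroup F] [NormedSpace ℝ F]
    (α : Fin m → ℕ) (g : Euc m → F) (D : Set (Euc m)) (x : Euc m) : F :=
  iteratedFDerivWithin ℝ (∑ i, α i) g D x (multiIndexDirections α)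

section Manifold

variable {m : ℕ} {H : Type*} [TopologicalSpace H] (I : ModelWithCorners ℝ (Euc m) H)
  {M : Type*} [TopologicalSpace M] [ChartedSpace H M]

/-- `Q` restricts to a smooth embedding of `D ⊆ ℝᵐ` in `M`: smooth on `D`, an immersion at each
point of `D`, and a homeomorphism of `D` onto its image. Values of `Q` outside `D` are irrelevant. -/
structure IsEmbeddingOn (Q : Euc m → M) (D : Set (Euc m)) : Prop where
  contMDiffOn : ContMDiffOn 𝓘(ℝ, Euc m) I ∞ Q D
  injective_mfderivWithin :
    ∀ x ∈ D, Function.Injective (mfderivWithin 𝓘(ℝ, Euc m) I Q D x)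
  isEmbedding : Topology.IsEmbedding (D.domRestrict Q)

variable (M) in
/-- An embedding in `M` of a compact subset of `ℝᵐ`. -/
structure CompactEmbedding where
  domain : Set (Euc m)
  toFun : Euc m → M
  isCompact_domain : IsCompact domain
  isEmbeddingOn : IsEmbeddingOn I toFun domain

variable (M) in
/-- The vector space `𝒞ʳ(M, ℝᵏ)`, for `r ∈ ℕ ∪ {∞}`. -/
abbrev CrMap (r : ℕ∞) (k : ℕ) : Type _ :=
  C^(r : WithTop ℕ∞)⟮I, M; 𝓘(ℝ, Euc k), Euc k⟯

end Manifold

section Bounds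

theorem norm_multiIndexDirections {m : ℕ} (α : Fin m → ℕ) (l : Fin (∑ i, α i)) :
    ‖multiIndexDirections α l‖ = 1 := by
  simp [multiIndexDirections]

theorem norm_partialDerivOn_le {m : ℕ} {F : Type*} [NormedAddCommGroup F] [NormedSpace ℝ F]
    (α : Fin m → ℕ) (g : Euc m → F) (D : Set (Euc m)) (x : Euc m) :
    ‖partialDerivOn α g D x‖ ≤ ‖iteratedFDerivWithin ℝ (∑ i, α i) g D x‖ := by
  refine (ContinuousMultilinearMap.le_opNorm _ _).trans ?_
  simp [norm_multiIndexDirections]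

/-- The derivatives of a `Cˢ` function on a compact set are bounded on the interior. -/
theorem exists_bound_iteratedFDerivWithin {E F : Type*} [NormedAddCommGroup E] [NormedSpace ℝ E]
    [NormedAddCommGroup F] [NormedSpace ℝ F] {g : E → F} {D : Set E} {s n : ℕ}
    (hD : IsCompact D) (hg : ContDiffOn ℝ s g D) (hn : n ≤ s) :
    ∃ C : ℝ, ∀ x ∈ interior D, ‖iteratedFDerivWithin ℝ n g D x‖ ≤ C := by
  have key : ∃ C : ℝ, ∀ x ∈ D ∩ interior D, ‖iteratedFDerivWithin ℝ n g D x‖ ≤ C := by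
    refine hD.induction_on
      (p := fun S => ∃ C : ℝ, ∀ x ∈ S ∩ interior D, ‖iteratedFDerivWithin ℝ n g D x‖ ≤ C)
      ⟨0, by simp⟩ ?_ ?_ ?_
    · rintro S T hST ⟨C, hC⟩
      exact ⟨C, fun x hx => hC x ⟨hST hx.1, hx.2⟩⟩
    · rintro S T ⟨C, hC⟩ ⟨C', hC'⟩
      refine ⟨max C C', ?_⟩
      rintro x ⟨hx | hx, hx'⟩
      · exact (hC x ⟨hx, hx'⟩).trans (le_max_left _ _)
      · exact (hC' x ⟨hx, hx'⟩).trans (le_max_right _ _)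
    · intro x hx
      obtain ⟨u, hu, p, hp⟩ := contDiffWithinAt_nat.1 (hg x hx)
      rw [Set.insert_eq_of_mem hx] at hu
      have hxu : x ∈ u := mem_of_mem_nhdsWithin hx hu
      have hcont : ContinuousWithinAt (fun y => ‖p y n‖) u x :=
        ((hp.cont n (by exact_mod_cast hn)) x hxu).norm
      have hlt : ∀ᶠ y in nhdsWithin x u, ‖p y n‖ < ‖p x n‖ + 1 :=
        hcont.eventually (gt_mem_nhds (lt_add_one _))
      have hlt' : ∀ᶠ y in nhdsWithin x D, ‖p y n‖ < ‖p x n‖ + 1 :=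
        nhdsWithin_le_of_mem hu hlt
      obtain ⟨V, hVo, hxV, hV⟩ := mem_nhdsWithin.1 hu
      refine ⟨{y | ‖p y n‖ < ‖p x n‖ + 1} ∩ V,
        Filter.inter_mem hlt' (mem_nhdsWithin_of_mem_nhds (hVo.mem_nhds hxV)), ‖p x n‖ + 1, ?_⟩
      rintro y ⟨⟨hy1, hyV⟩, hyD⟩
      have hopen : IsOpen (V ∩ interior D) := hVo.inter isOpen_interior
      have hp' : HasFTaylorSeriesUpToOn s g p (V ∩ interior D) :=
        hp.mono fun z hz => hV ⟨hz.1, interior_subset hz.2⟩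
      have h1 : p y n = iteratedFDerivWithin ℝ n g (V ∩ interior D) y :=
        hp'.eq_iteratedFDerivWithin_of_uniqueDiffOn (by exact_mod_cast hn)
          hopen.uniqueDiffOn ⟨hyV, hyD⟩
      have h2 : iteratedFDerivWithin ℝ n g (V ∩ interior D) y = iteratedFDerivWithin ℝ n g D y := by
        refine iteratedFDerivWithin_congr_set ?_ n
        filter_upwards [hopen.mem_nhds ⟨hyV, hyD⟩] with z hz
        exact propext ⟨fun _ => interior_subset hz.2, fun _ => hz⟩
      rw [← h2, ← h1]
      exact le_of_lt hy1
  obtain ⟨C, hC⟩ := key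
  exact ⟨C, fun x hx => hC x ⟨interior_subset hx, hx⟩⟩

end Bounds

section Topology

variable {m : ℕ} {H : Type*} [TopologicalSpace H] {I : ModelWithCorners ℝ (Euc m) H}
  {M : Type*} [TopologicalSpace M] [ChartedSpace H M] {r : ℕ∞} {k : ℕ}

theorem CompactEmbedding.contDiffOn_comp (P : CompactEmbedding I M) (f : CrMap I M r k) :
    ContDiffOn ℝ r (f ∘ P.toFun) P.domain := by
  rw [← contMDiffOn_iff_contDiffOn]
  exact f.contMDiff.comp_contMDiffOn
    (P.isEmbeddingOn.contMDiffOn.of_le (by exact_mod_cast (le_top : r ≤ ⊤)))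

/-- The pairs `(α, x)` over which the supremum in `‖f‖_{Q,s}` is taken: `|α| ≤ s` and
`x ∈ int D`. -/
abbrev CompactEmbedding.Range (P : CompactEmbedding I M) (s : ℕ) : Type :=
  {α : Fin m → ℕ // ∑ i, α i ≤ s} × interior P.domain

theorem CompactEmbedding.bddAbove (P : CompactEmbedding I M) {s : ℕ} (hs : (s : ℕ∞) ≤ r)
    (f : CrMap I M r k) :
    BddAbove (Set.range fun a : P.Range s =>
      ‖partialDerivOn a.1.1 (f ∘ P.toFun) P.domain a.2‖) := by
  have hg : ContDiffOn ℝ s (f ∘ P.toFun) P.domain :=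
    (P.contDiffOn_comp f).of_le (by exact_mod_cast hs)
  have h : ∀ n : ℕ, ∃ C : ℝ, n ≤ s → ∀ x ∈ interior P.domain,
      ‖iteratedFDerivWithin ℝ n (f ∘ P.toFun) P.domain x‖ ≤ C := by
    intro n
    by_cases hn : n ≤ s
    · obtain ⟨C, hC⟩ := exists_bound_iteratedFDerivWithin P.isCompact_domain hg hn
      exact ⟨C, fun _ => hC⟩
    · exact ⟨0, fun h => absurd h hn⟩
  choose C hC using h
  refine ⟨∑ n ∈ Finset.range (s + 1), |C n|, ?_⟩
  rintro _ ⟨⟨⟨α, hα⟩, x⟩, rfl⟩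
  calc ‖partialDerivOn α (f ∘ P.toFun) P.domain x‖
      ≤ C (∑ i, α i) := (norm_partialDerivOn_le _ _ _ _).trans (hC _ hα x x.2)
    _ ≤ |C (∑ i, α i)| := le_abs_self _
    _ ≤ ∑ n ∈ Finset.range (s + 1), |C n| :=
      Finset.single_le_sum (f := fun n => |C n|) (fun _ _ => abs_nonneg _)
        (Finset.mem_range.2 (Nat.lt_succ_of_le hα))

theorem partialDerivOn_add_interior {F : Type*} [NormedAddCommGroup F] [NormedSpace ℝ F]
    {α : Fin m → ℕ} {f g : Euc m → F} {D : Set (Euc m)} {x : Euc m} (hx : x ∈ interior D)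
    (hf : ContDiffOn ℝ (∑ i, α i : ℕ) f D) (hg : ContDiffOn ℝ (∑ i, α i : ℕ) g D) :
    partialDerivOn α (f + g) D x = partialDerivOn α f D x + partialDerivOn α g D x := by
  have hset : D =ᶠ[nhds x] interior D := by
    filter_upwards [isOpen_interior.mem_nhds hx] with z hz
    exact propext ⟨fun _ => hz, fun _ => interior_subset hz⟩
  simp only [partialDerivOn, iteratedFDerivWithin_congr_set hset]
  rw [iteratedFDerivWithin_add_apply ((hf.mono interior_subset) x hx)
    ((hg.mono interior_subset) x hx) isOpen_interior.uniqueDiffOn hx]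
  rfl

theorem partialDerivOn_smul_interior {F : Type*} [NormedAddCommGroup F] [NormedSpace ℝ F]
    {α : Fin m → ℕ} {f : Euc m → F} {D : Set (Euc m)} {x : Euc m} (hx : x ∈ interior D) (c : ℝ)
    (hf : ContDiffOn ℝ (∑ i, α i : ℕ) f D) :
    partialDerivOn α (c • f) D x = c • partialDerivOn α f D x := by
  have hset : D =ᶠ[nhds x] interior D := by
    filter_upwards [isOpen_interior.mem_nhds hx] with z hz
    exact propext ⟨fun _ => hz, fun _ => interior_subset hz⟩
  simp only [partialDerivOn, iteratedFDerivWithin_congr_set hset]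
  rw [iteratedFDerivWithin_const_smul_apply ((hf.mono interior_subset) x hx)
    isOpen_interior.uniqueDiffOn hx]
  rfl

/-- The seminorm
`‖f‖_{Q,s} = sup {|∂_α (f ∘ Q) (x)| : α ∈ ℕᵐ, |α| ≤ s, x ∈ int D}` on `𝒞ʳ(M, ℝᵏ)`, for an embedding
`Q` of a compact set `D ⊆ ℝᵐ` and a natural number `s ≤ r`. -/
def weakSeminorm (P : CompactEmbedding I M) (s : ℕ) (hs : (s : ℕ∞) ≤ r) :
    Seminorm ℝ (CrMap I M r k) :=
  Seminorm.of
    (fun f => ⨆ a : P.Range s, ‖partialDerivOn a.1.1 (f ∘ P.toFun) P.domain a.2‖)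
    (fun f g => by
      have hC : ∀ f : CrMap I M r k, ∀ α : Fin m → ℕ, ∑ i, α i ≤ s →
          ContDiffOn ℝ (∑ i, α i : ℕ) (f ∘ P.toFun) P.domain := fun f α hα =>
        (P.contDiffOn_comp f).of_le
          (by exact_mod_cast (Nat.cast_le.2 hα : ((∑ i, α i : ℕ) : ℕ∞) ≤ s).trans hs)
      refine Real.iSup_le (fun a => ?_)
        (add_nonneg (Real.iSup_nonneg fun _ => norm_nonneg _)
          (Real.iSup_nonneg fun _ => norm_nonneg _))
      have h : partialDerivOn a.1.1 ((f + g : CrMap I M r k) ∘ P.toFun) P.domain a.2 =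
          partialDerivOn a.1.1 (f ∘ P.toFun) P.domain a.2 +
            partialDerivOn a.1.1 (g ∘ P.toFun) P.domain a.2 :=
        partialDerivOn_add_interior a.2.2 (hC f _ a.1.2) (hC g _ a.1.2)
      rw [h]
      exact (norm_add_le _ _).trans
        (add_le_add (le_ciSup (P.bddAbove hs f) a) (le_ciSup (P.bddAbove hs g) a)))
    (fun c f => by
      rw [Real.mul_iSup_of_nonneg (norm_nonneg c)]
      refine iSup_congr fun a => ?_
      have h : partialDerivOn a.1.1 ((c • f : CrMap I M r k) ∘ P.toFun) P.domain a.2 =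
          c • partialDerivOn a.1.1 (f ∘ P.toFun) P.domain a.2 :=
        partialDerivOn_smul_interior a.2.2 c ((P.contDiffOn_comp f).of_le
          (by exact_mod_cast (Nat.cast_le.2 a.1.2 : ((∑ i, a.1.1 i : ℕ) : ℕ∞) ≤ s).trans hs))
      rw [h, norm_smul])

/-- The weak Whitney topology on `𝒞ʳ(M, ℝᵏ)`: the topology defined by the seminorms `‖·‖_{Q,s}`,
for all embeddings `Q` of compact subsets of `ℝᵐ` and all finite `s ≤ r`. -/
instance weakWhitneyTopology : TopologicalSpace (CrMap I M r k) :=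
  ⨅ (P : CompactEmbedding I M) (s : {s : ℕ // (s : ℕ∞) ≤ r}),
    (weakSeminorm (k := k) P s.1 s.2).toSeminormedAddCommGroup.toUniformSpace.toTopologicalSpace

end Topology

section Dual

variable {m : ℕ} {H : Type*} [TopologicalSpace H] (I : ModelWithCorners ℝ (Euc m) H)
  (M : Type*) [TopologicalSpace M] [ChartedSpace H M] (r : ℕ∞) (k : ℕ)

/-- The closed unit disk `𝔻ᵐ ⊆ ℝᵐ`. -/
abbrev unitDisk (m : ℕ) : Set (Euc m) := Metric.closedBall 0 1

/-- The topological dual of `𝒞ʳ(M, ℝᵏ)`, with the weak-* topology. -/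
abbrev CrDual : Type _ := WeakDual ℝ (CrMap I M r k)

/-- The set of the continuous linear functionals on `𝒞ʳ(M, ℝᵏ)` of the form
`T(f) = ∫_{𝔻ᵐ} ∂_α (fʲ ∘ Q) dμ`, for some embedding `Q` of the disk `𝔻ᵐ` in `M`, some multi-index `α`
with `|α| ≤ r`, some `j` and some finite signed Borel measure `μ` on `𝔻ᵐ`. -/
def localFunctionals : Set (CrDual I M r k) :=
  {T | ∃ (Q : Euc m → M) (α : Fin m → ℕ) (j : Fin k) (μ : MeasureTheory.SignedMeasure (unitDisk m)),
    IsEmbeddingOn I Q (unitDisk m) ∧ ((∑ i, α i : ℕ) : ℕ∞) ≤ r ∧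
    ∀ f : CrMap I M r k,
      T f = ∫ᵛ u, partialDerivOn α (fun x => f (Q x) j) (unitDisk m) u ∂<•μ}

/-- The set `δ_M` of the continuous linear functionals `f ↦ fʲ(p)`, with `p ∈ M` and
`j ∈ {1, …, k}`. -/
def pointEvaluations : Set (CrDual I M r k) :=
  {T | ∃ (p : M) (j : Fin k), ∀ f : CrMap I M r k, T f = f p j}

end Dual

end

/-!
The weak Whitney topology is generated by the seminorms `f ↦ sup |∂_α (fʲ ∘ Q)|`, where `Q` runs
through the embeddings of the closed unit disk only. Indeed every point of `M` has a neighbourhood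
covered by an embedded disk with smooth inverse, so that an embedding of a compact set locally
factors through disks, and by the chain rule the derivatives along it are bounded by the derivatives
along finitely many disks. At a boundary point of `M` a round disk does not cover a neighbourhood;
one shears it along the inward normal, so that its lower hemisphere becomes flat near the pole.

By the Hahn-Banach theorem a continuous functional on such a space is a finite sum of functionals
`f ↦ l (∂_α (fʲ ∘ Q))` with `l` continuous and linear on `C(𝔻ᵐ)`, and by the Riesz-Markov theorem
`l` is the integral against a signed measure. Finally, the dual of the weak-* dual of `𝒞ʳ(M, ℝᵏ)` is
`𝒞ʳ(M, ℝᵏ)` itself, whose elements are determined by their values at points, so again by the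
Hahn-Banach theorem the point evaluations span a dense subspace.
-/

section FunctionalAnalysis

open MeasureTheory

theorem posPart_smul_of_pos {E : Type*} [AddCommGroup E] [Lattice E] [Module ℝ E]
    [IsOrderedModule ℝ E] {c : ℝ} (hc : 0 < c) (x : E) : (c • x)⁺ = c • x⁺ := by
  simpa only [posPart_def, OrderIso.smulRight_apply, smul_zero] using
    ((OrderIso.smulRight hc).map_sup x 0).symm

section PositiveFunctionals

variable {E : Type*} [NormedAddCommGroup E] [Lattice E] [HasSolidNorm E] [IsOrderedAddMonoid E]

theorem norm_posPart_add_le (x y : E) : ‖(x + y)⁺‖ ≤ ‖x⁺‖ + ‖y⁺‖ := by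
  have hle : (x + y)⁺ ≤ x⁺ + y⁺ :=
    sup_le (add_le_add (le_posPart x) (le_posPart y))
      (add_nonneg (posPart_nonneg x) (posPart_nonneg y))
  calc ‖(x + y)⁺‖ ≤ ‖x⁺ + y⁺‖ :=
        HasSolidNorm.solid (abs_le_abs_of_nonneg (posPart_nonneg _) hle)
    _ ≤ ‖x⁺‖ + ‖y⁺‖ := norm_add_le _ _

variable [NormedSpace ℝ E] [IsOrderedModule ℝ E]

/-- The sublinear function `(x, y) ↦ ‖l‖ (‖x⁺‖ + ‖y⁺‖)` vanishes on the negative cone of `E × E` and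
dominates `(x, -x) ↦ l x`, so that Hahn-Banach extends the latter to a positive functional. -/
theorem exists_eq_sub_positiveLinearMap (l : E →L[ℝ] ℝ) :
    ∃ φ ψ : E →ₚ[ℝ] ℝ, ∀ x, l x = φ x - ψ x := by
  let diagonal : Submodule ℝ (E × E) := LinearMap.range (LinearMap.id.prod (-LinearMap.id))
  let N : E × E → ℝ := fun a => ‖l‖ * (‖a.1⁺‖ + ‖a.2⁺‖)
  obtain ⟨g, hgl, hgN⟩ := exists_extension_of_le_sublinear
    ⟨diagonal, (l.toLinearMap ∘ₗ LinearMap.fst ℝ E E).domRestrict diagonal⟩ N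
    (fun c hc a => by
      simp only [N, Prod.smul_fst, Prod.smul_snd, posPart_smul_of_pos hc, norm_smul,
        Real.norm_of_nonneg hc.le]
      ring)
    (fun a b => by
      simp only [N, ← mul_add, Prod.fst_add, Prod.snd_add]
      gcongr ‖l‖ * ?_
      linarith [norm_posPart_add_le a.1 b.1, norm_posPart_add_le a.2 b.2])
    (by
      rintro ⟨-, x, rfl⟩
      calc l x ≤ ‖l‖ * ‖x⁺ - x⁻‖ := by
            rw [posPart_sub_negPart]
            exact (le_abs_self _).trans (l.le_opNorm x)
        _ ≤ ‖l‖ * (‖x⁺‖ + ‖x⁻‖) := by gcongr; exact norm_sub_le _ _)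
  have hN {a : E × E} (ha : 0 ≤ a) : 0 ≤ g a := by
    have h := hgN (-a)
    simp only [N, map_neg, Prod.fst_neg, Prod.snd_neg, posPart_eq_zero.2 (neg_nonpos.2 ha.1),
      posPart_eq_zero.2 (neg_nonpos.2 ha.2), norm_zero, add_zero, mul_zero] at h
    linarith
  refine ⟨.mk₀ (g ∘ₗ LinearMap.inl ℝ E E) fun x hx => hN ⟨hx, le_rfl⟩,
    .mk₀ (g ∘ₗ LinearMap.inr ℝ E E) fun x hx => hN ⟨le_rfl, hx⟩, fun x => ?_⟩
  calc l x = g (x, -x) := (hgl ⟨(x, -x), x, rfl⟩).symm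
    _ = g ((x, 0) - (0, x)) := by simp
    _ = g (x, 0) - g (0, x) := map_sub g _ _

end PositiveFunctionals

section RieszMarkov

variable {X : Type*} [TopologicalSpace X] [CompactSpace X]

instance : HasSolidNorm C(X, ℝ) where
  solid f g h := (ContinuousMap.norm_le f (norm_nonneg g)).2 fun x =>
    (h x).trans (g.norm_coe_le_norm x)

variable [MeasurableSpace X]

theorem integrable_toSignedMeasure [OpensMeasurableSpace X] (μ : Measure X) [IsFiniteMeasure μ]
    (f : C(X, ℝ)) : μ.toSignedMeasure.Integrable f := by
  simpa [VectorMeasure.Integrable] using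
    f.continuous.integrable_of_hasCompactSupport (HasCompactSupport.of_compactSpace f)

variable [T2Space X] [BorelSpace X]

open scoped CompactlySupported in
theorem exists_measure_integral_eq (φ : C(X, ℝ) →ₚ[ℝ] ℝ) :
    ∃ μ : Measure X, IsFiniteMeasure μ ∧ ∀ f : C(X, ℝ), φ f = ∫ x, f x ∂μ := by
  let Λ : C_c(X, ℝ) →ₚ[ℝ] ℝ := .mk₀
    { toFun f := φ f.toContinuousMap
      map_add' f g := map_add φ f.toContinuousMap g.toContinuousMap
      map_smul' c f := map_smul φ c f.toContinuousMap } fun f hf => map_nonneg φ hf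
  exact ⟨RealRMK.rieszMeasure Λ, inferInstance, fun f =>
    (RealRMK.integral_rieszMeasure Λ ⟨f, HasCompactSupport.of_compactSpace _⟩).symm⟩

theorem exists_signedMeasure_integral_eq (l : C(X, ℝ) →L[ℝ] ℝ) :
    ∃ μ : SignedMeasure X, ∀ f : C(X, ℝ), l f = ∫ᵛ x, f x ∂<•μ := by
  obtain ⟨φ, ψ, hl⟩ := exists_eq_sub_positiveLinearMap l
  obtain ⟨μ, _, hμ⟩ := exists_measure_integral_eq φ
  obtain ⟨ν, _, hν⟩ := exists_measure_integral_eq ψ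
  refine ⟨μ.toSignedMeasure - ν.toSignedMeasure, fun f => ?_⟩
  rw [VectorMeasure.integral_sub_vectorMeasure (integrable_toSignedMeasure μ f)
    (integrable_toSignedMeasure ν f), VectorMeasure.integral_toSignedMeasure,
    VectorMeasure.integral_toSignedMeasure, hl, hμ, hν]

end RieszMarkov

section Domination

variable {𝕜 E : Type*} [RCLike 𝕜] [AddCommGroup E] [Module 𝕜 E]

theorem exists_eq_comp_of_norm_le {F : Type*} [NormedAddCommGroup F] [NormedSpace 𝕜 F]
    {T : E →ₗ[𝕜] 𝕜} {K : E →ₗ[𝕜] F} {C : ℝ} (hT : ∀ f, ‖T f‖ ≤ C * ‖K f‖) :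
    ∃ l : F →L[𝕜] 𝕜, ∀ f, T f = l (K f) := by
  have hker : LinearMap.ker K ≤ LinearMap.ker T := fun f hf => by
    simpa [LinearMap.mem_ker.1 hf] using hT f
  let T' : LinearMap.range K →ₗ[𝕜] 𝕜 :=
    (LinearMap.ker K).liftQ T hker ∘ₗ K.quotKerEquivRange.symm.toLinearMap
  have hT' (f : E) : T' ⟨K f, f, rfl⟩ = T f := by
    simp [T', K.quotKerEquivRange_symm_apply_image f ⟨f, rfl⟩]
  obtain ⟨l, hl, -⟩ := exists_extension_norm_eq (LinearMap.range K) <|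
    T'.mkContinuous C (by rintro ⟨-, f, rfl⟩; exact (congrArg norm (hT' f)).trans_le (hT f))
  exact ⟨l, fun f => ((hl ⟨K f, f, rfl⟩).trans (hT' f)).symm⟩

theorem exists_eq_sum_comp_of_withSeminorms {ι : Type*} [TopologicalSpace E] {F : ι → Type*}
    [∀ i, NormedAddCommGroup (F i)] [∀ i, NormedSpace 𝕜 (F i)] {J : ∀ i, E →ₗ[𝕜] F i}
    (hJ : WithSeminorms fun i => (normSeminorm 𝕜 (F i)).comp (J i)) (T : E →L[𝕜] 𝕜) :
    ∃ (A : Finset ι) (l : ∀ i : A, F i →L[𝕜] 𝕜), ∀ f, T f = ∑ i : A, l i (J i f) := by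
  classical
  obtain ⟨A, C, -, hT⟩ := Seminorm.bound_of_continuous hJ
    ((normSeminorm 𝕜 𝕜).comp T.toLinearMap) (continuous_norm.comp T.continuous)
  obtain ⟨l, hl⟩ := exists_eq_comp_of_norm_le (T := T.toLinearMap)
    (K := LinearMap.pi fun i : A => J i) (C := C) fun f => (hT f).trans <| by
      rw [smul_apply, NNReal.smul_def, smul_eq_mul]
      gcongr
      exact Seminorm.finset_sup_apply_le (norm_nonneg _) fun i hi =>
        norm_le_pi_norm (fun i : A => J i f) ⟨i, hi⟩
  refine ⟨A, fun i => l ∘L ContinuousLinearMap.single 𝕜 (fun i : A => F i) i, fun f => ?_⟩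
  calc T f = l (∑ i : A, Pi.single i (J i f)) := by
        rw [Finset.univ_sum_single]
        exact hl f
    _ = ∑ i : A, l (Pi.single i (J i f)) := map_sum l _ _

end Domination

section WeakDual

variable {E : Type*} [AddCommGroup E] [Module ℝ E] [TopologicalSpace E]

theorem exists_forall_eq_apply_weakDual (F : WeakDual ℝ E →L[ℝ] ℝ) : ∃ e : E, ∀ φ, F φ = φ e := by
  obtain ⟨e, he⟩ := LinearMap.dualEmbedding_surjective (topDualPairing ℝ E) F
  exact ⟨e, fun φ => by rw [← he]; rfl⟩

theorem closure_span_eq_univ_of_separating {S : Set (WeakDual ℝ E)}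
    (hS : ∀ f : E, (∀ φ ∈ S, φ f = 0) → f = 0) :
    closure (Submodule.span ℝ S : Set (WeakDual ℝ E)) = Set.univ := by
  rw [Set.eq_univ_iff_forall]
  by_contra! ⟨T, hT⟩
  have : LocallyConvexSpace ℝ (WeakDual ℝ E) :=
    inferInstanceAs (LocallyConvexSpace ℝ (WeakBilin (topDualPairing ℝ E)))
  obtain ⟨F, u, hF, hu⟩ := geometric_hahn_banach_closed_point (E := WeakDual ℝ E)
    (Submodule.span ℝ S).convex.closure isClosed_closure hT
  have h0 : 0 < u := by simpa using hF 0 (subset_closure (Submodule.zero_mem _))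
  obtain ⟨e, he⟩ := exists_forall_eq_apply_weakDual F
  have he0 : e = 0 := hS e fun φ hφ => by
    rw [← he]
    by_contra hne
    have := hF ((u / F φ) • φ) (subset_closure (Submodule.smul_mem _ _ (Submodule.subset_span hφ)))
    rw [map_smul, smul_eq_mul, div_mul_cancel₀ _ hne] at this
    exact lt_irrefl _ this
  rw [he, he0, map_zero] at hu
  exact lt_asymm h0 hu

end WeakDual

end FunctionalAnalysis

section SymmetricDerivatives

variable {𝕜 E F : Type*} [RCLike 𝕜] [NormedAddCommGroup E] [NormedSpace 𝕜 E]
  [NormedAddCommGroup F] [NormedSpace 𝕜 F] {n : ℕ} {f : E → F} {x : E}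

theorem iteratedFDeriv_succ_apply_eq_fderiv (hf : ContDiffAt 𝕜 (n + 1 : ℕ) f x)
    (v : Fin (n + 1) → E) :
    iteratedFDeriv 𝕜 (n + 1) f x v =
      fderiv 𝕜 (fun y => iteratedFDeriv 𝕜 n f y (Fin.tail v)) x (v 0) :=
  ((hf.iteratedFDeriv_right (m := 1) (by norm_cast; omega)).differentiableAt
    one_ne_zero).iteratedFDeriv_succ_apply_left'

theorem contDiffAt_iteratedFDeriv_apply {j : ℕ} (hf : ContDiffAt 𝕜 (n + j : ℕ) f x)
    (v : Fin n → E) : ContDiffAt 𝕜 j (fun y => iteratedFDeriv 𝕜 n f y v) x :=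
  (ContinuousMultilinearMap.apply 𝕜 (fun _ : Fin n => E) F v).contDiff.contDiffAt.comp x
    (hf.iteratedFDeriv_right (by norm_cast; omega))

theorem iteratedFDeriv_add_two_apply (hf : ContDiffAt 𝕜 (n + 2 : ℕ) f x) (v : Fin (n + 2) → E) :
    iteratedFDeriv 𝕜 (n + 2) f x v =
      fderiv 𝕜 (fderiv 𝕜 fun y => iteratedFDeriv 𝕜 n f y (Fin.tail (Fin.tail v))) x
        (v 0) (v 1) := by
  set g : E → F := fun y => iteratedFDeriv 𝕜 n f y (Fin.tail (Fin.tail v))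
  have hd : DifferentiableAt 𝕜 (fderiv 𝕜 g) x :=
    ((contDiffAt_iteratedFDeriv_apply hf _).fderiv_right (m := 1) le_rfl).differentiableAt
      one_ne_zero
  have hg : (fun y => iteratedFDeriv 𝕜 (n + 1) f y (Fin.tail v)) =ᶠ[nhds x]
      fun y => fderiv 𝕜 g y (v 1) := by
    filter_upwards [hf.eventually (ENat.natCast_ne_coe_top _)] with y hy
    exact iteratedFDeriv_succ_apply_eq_fderiv (hy.of_le (by norm_cast; omega)) _
  rw [iteratedFDeriv_succ_apply_eq_fderiv hf, hg.fderiv_eq,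
    fderiv_clm_apply hd (differentiableAt_const _)]
  simp

theorem iteratedFDeriv_comp_swap_zero_one (hf : ContDiffAt 𝕜 (n + 2 : ℕ) f x)
    (v : Fin (n + 2) → E) :
    iteratedFDeriv 𝕜 (n + 2) f x (v ∘ Equiv.swap 0 1) = iteratedFDeriv 𝕜 (n + 2) f x v := by
  have htail : Fin.tail (Fin.tail (v ∘ Equiv.swap 0 1)) = Fin.tail (Fin.tail v) := by
    funext l
    simp only [Fin.tail, Function.comp_apply]
    rw [Equiv.swap_apply_of_ne_of_ne (Fin.succ_ne_zero _) (by simp [Fin.ext_iff])]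
  rw [iteratedFDeriv_add_two_apply hf, iteratedFDeriv_add_two_apply hf, htail,
    ((contDiffAt_iteratedFDeriv_apply hf _).isSymmSndFDerivAt (by simp)).eq]
  simp

theorem iteratedFDeriv_comp_swap_castSucc_succ (hf : ContDiffAt 𝕜 (n + 1 : ℕ) f x)
    (v : Fin (n + 1) → E) (i : Fin n) :
    iteratedFDeriv 𝕜 (n + 1) f x (v ∘ Equiv.swap i.castSucc i.succ) =
      iteratedFDeriv 𝕜 (n + 1) f x v := by
  induction n generalizing x with
  | zero => exact i.elim0
  | succ n ih =>
    cases i using Fin.cases with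
    | zero => exact iteratedFDeriv_comp_swap_zero_one hf v
    | succ j =>
      have hhead : (v ∘ Equiv.swap j.succ.castSucc j.succ.succ) 0 = v 0 := by
        simp only [Function.comp_apply]
        rw [Equiv.swap_apply_of_ne_of_ne] <;> simp [Fin.ext_iff]
      have htail : Fin.tail (v ∘ Equiv.swap j.succ.castSucc j.succ.succ) =
          Fin.tail v ∘ Equiv.swap j.castSucc j.succ := by
        funext l
        simp only [Fin.tail, Function.comp_apply, ← Fin.succ_castSucc,
          (Fin.succ_injective _).map_swap]
      have hswap : (fun y => iteratedFDeriv 𝕜 (n + 1) f y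
          (Fin.tail v ∘ Equiv.swap j.castSucc j.succ)) =ᶠ[nhds x]
          fun y => iteratedFDeriv 𝕜 (n + 1) f y (Fin.tail v) := by
        filter_upwards [hf.eventually (ENat.natCast_ne_coe_top _)] with y hy
        exact ih (hy.of_le (by norm_cast; omega)) _ _
      rw [iteratedFDeriv_succ_apply_eq_fderiv hf, iteratedFDeriv_succ_apply_eq_fderiv hf, hhead,
        htail, hswap.fderiv_eq]

theorem iteratedFDeriv_comp_perm (hf : ContDiffAt 𝕜 n f x) (v : Fin n → E)
    (σ : Equiv.Perm (Fin n)) : iteratedFDeriv 𝕜 n f x (v ∘ σ) = iteratedFDeriv 𝕜 n f x v := by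
  cases n with
  | zero => exact congrArg _ (Subsingleton.elim _ _)
  | succ n =>
    have hσ : σ ∈ Submonoid.closure
        (Set.range fun i : Fin n => Equiv.swap i.castSucc i.succ) := by
      rw [Equiv.Perm.mclosure_swap_castSucc_succ]
      trivial
    induction hσ using Submonoid.closure_induction generalizing v with
    | mem _ h =>
      obtain ⟨i, rfl⟩ := h
      exact iteratedFDeriv_comp_swap_castSucc_succ hf v i
    | one => rfl
    | mul σ τ _ _ h h' => rw [← h v, ← h' (v ∘ σ)]; rfl

end SymmetricDerivatives

section PartialDerivatives

open Set

theorem opNorm_le_sum_norm_orthonormalBasis {𝕜 E F ι κ : Type*} [RCLike 𝕜] [NormedAddCommGroup E]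
    [InnerProductSpace 𝕜 E] [NormedAddCommGroup F] [NormedSpace 𝕜 F] [Fintype ι]
    [DecidableEq ι] [Fintype κ] (b : OrthonormalBasis κ 𝕜 E)
    (A : ContinuousMultilinearMap 𝕜 (fun _ : ι => E) F) :
    ‖A‖ ≤ ∑ i : ι → κ, ‖A fun l => b (i l)‖ := by
  refine A.opNorm_le_bound (by positivity) fun v => ?_
  have hcoord (l : ι) (j : κ) : ‖b.repr (v l) j‖ ≤ ‖v l‖ :=
    (PiLp.norm_apply_le _ _).trans_eq (b.repr.norm_map _)
  have hexpand : A v = ∑ i : ι → κ, (∏ l, b.repr (v l) (i l)) • A fun l => b (i l) := by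
    conv_lhs => rw [← funext fun l => b.sum_repr (v l)]
    rw [A.map_sum]
    exact Finset.sum_congr rfl fun i _ => A.map_smul_univ _ _
  calc ‖A v‖ ≤ ∑ i : ι → κ, ‖(∏ l, b.repr (v l) (i l)) • A fun l => b (i l)‖ :=
        hexpand ▸ norm_sum_le _ _
    _ ≤ ∑ i : ι → κ, (∏ l, ‖v l‖) * ‖A fun l => b (i l)‖ := by
        simp only [norm_smul, norm_prod]
        gcongr
        exact hcoord _ _
    _ = (∑ i : ι → κ, ‖A fun l => b (i l)‖) * ∏ l, ‖v l‖ := by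
        rw [← Finset.mul_sum, mul_comm]

variable {m n : ℕ} {F : Type*} [NormedAddCommGroup F] [NormedSpace ℝ F] {α : Fin m → ℕ}
  {g : Euc m → F} {D : Set (Euc m)} {x : Euc m}

theorem exists_multiIndexDirections_comp (i : Fin n → Fin m) :
    ∃ (α : Fin m → ℕ) (e : Fin n ≃ Fin (∑ j, α j)),
      (fun l => EuclideanSpace.single (i l) 1) = multiIndexDirections α ∘ e := by
  classical
  let e : Fin n ≃ Fin (∑ j, Fintype.card {l // i l = j}) :=
    (Equiv.sigmaFiberEquiv i).symm.trans
      ((Equiv.sigmaCongrRight fun j => Fintype.equivFin {l // i l = j}).trans finSigmaFinEquiv)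
  exact ⟨_, e, funext fun l => by simp [multiIndexDirections, e]⟩

theorem exists_partialDerivOn_eq (hx : x ∈ interior D) (hg : ContDiffOn ℝ n g D)
    (i : Fin n → Fin m) :
    ∃ α : Fin m → ℕ, ∑ j, α j = n ∧
      iteratedFDerivWithin ℝ n g D x (fun l => EuclideanSpace.single (i l) 1) =
        partialDerivOn α g D x := by
  obtain ⟨α, e, he⟩ := exists_multiIndexDirections_comp i
  obtain rfl : n = ∑ j, α j := by simpa using Fintype.card_congr e
  have hD : D ∈ nhds x := mem_interior_iff_mem_nhds.1 hx
  refine ⟨α, rfl, ?_⟩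
  rw [he, partialDerivOn, iteratedFDerivWithin_congr_set (Filter.eventuallyEq_univ.2 hD),
    iteratedFDerivWithin_univ]
  exact iteratedFDeriv_comp_perm (hg.contDiffAt hD) _ e

theorem norm_iteratedFDerivWithin_le_of_mem_interior {B : ℝ} (hg : ContDiffOn ℝ n g D)
    (hx : x ∈ interior D) (hB : ∀ α : Fin m → ℕ, ∑ i, α i = n → ‖partialDerivOn α g D x‖ ≤ B) :
    ‖iteratedFDerivWithin ℝ n g D x‖ ≤ m ^ n * B :=
  calc ‖iteratedFDerivWithin ℝ n g D x‖
      ≤ ∑ i : Fin n → Fin m,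
          ‖iteratedFDerivWithin ℝ n g D x fun l => EuclideanSpace.basisFun (Fin m) ℝ (i l)‖ :=
        opNorm_le_sum_norm_orthonormalBasis _ _
    _ ≤ ∑ _i : Fin n → Fin m, B := Finset.sum_le_sum fun i _ => by
        obtain ⟨α, hα, h⟩ := exists_partialDerivOn_eq hx hg i
        simpa only [EuclideanSpace.basisFun_apply, h] using hB α hα
    _ = m ^ n * B := by simp

theorem norm_iteratedFDerivWithin_le_of_closure_interior {B : ℝ} (hD : closure (interior D) = D)
    (hD' : UniqueDiffOn ℝ D) (hg : ContDiffOn ℝ n g D)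
    (hB : ∀ α : Fin m → ℕ, ∑ i, α i = n → ∀ x ∈ interior D, ‖partialDerivOn α g D x‖ ≤ B)
    (hx : x ∈ D) : ‖iteratedFDerivWithin ℝ n g D x‖ ≤ m ^ n * B :=
  le_on_closure (s := interior D) (f := fun x => ‖iteratedFDerivWithin ℝ n g D x‖)
    (fun _ hy => norm_iteratedFDerivWithin_le_of_mem_interior hg hy fun α hα => hB α hα _ hy)
    (by rw [hD]; exact (hg.continuousOn_iteratedFDerivWithin le_rfl hD').norm)
    continuousOn_const (hD.symm ▸ hx)

theorem continuousOn_partialDerivOn (hD : UniqueDiffOn ℝ D)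
    (hg : ContDiffOn ℝ (∑ i, α i : ℕ) g D) : ContinuousOn (partialDerivOn α g D) D :=
  (ContinuousMultilinearMap.apply ℝ (fun _ => Euc m) F
    (multiIndexDirections α)).continuous.comp_continuousOn
    (hg.continuousOn_iteratedFDerivWithin le_rfl hD)

theorem partialDerivOn_comp_left {G : Type*} [NormedAddCommGroup G] [NormedSpace ℝ G]
    (L : F →L[ℝ] G) (hD : UniqueDiffOn ℝ D) (hg : ContDiffOn ℝ (∑ i, α i : ℕ) g D) (hx : x ∈ D) :
    partialDerivOn α (L ∘ g) D x = L (partialDerivOn α g D x) :=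
  congrArg (fun A : ContinuousMultilinearMap ℝ (fun _ : Fin (∑ i, α i) => Euc m) G =>
    A (multiIndexDirections α)) (L.iteratedFDerivWithin_comp_left (hg x hx) hD hx le_rfl)

theorem partialDerivOn_add {g' : Euc m → F} (hD : UniqueDiffOn ℝ D)
    (hg : ContDiffOn ℝ (∑ i, α i : ℕ) g D) (hg' : ContDiffOn ℝ (∑ i, α i : ℕ) g' D) (hx : x ∈ D) :
    partialDerivOn α (g + g') D x = partialDerivOn α g D x + partialDerivOn α g' D x :=
  congrArg (fun A : ContinuousMultilinearMap ℝ (fun _ : Fin (∑ i, α i) => Euc m) F =>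
    A (multiIndexDirections α)) (iteratedFDerivWithin_add_apply (hg x hx) (hg' x hx) hD hx)

theorem partialDerivOn_const_smul (c : ℝ) (hD : UniqueDiffOn ℝ D)
    (hg : ContDiffOn ℝ (∑ i, α i : ℕ) g D) (hx : x ∈ D) :
    partialDerivOn α (c • g) D x = c • partialDerivOn α g D x :=
  congrArg (fun A : ContinuousMultilinearMap ℝ (fun _ : Fin (∑ i, α i) => Euc m) F =>
    A (multiIndexDirections α)) (iteratedFDerivWithin_const_smul_apply (hg x hx) hD hx)

theorem partialDerivOn_zero : partialDerivOn 0 g D x = g x := by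
  have h (n : ℕ) (hn : n = 0) (v : Fin n → Euc m) : iteratedFDerivWithin ℝ n g D x v = g x := by
    subst hn
    exact iteratedFDerivWithin_zero_apply v
  exact h _ Finset.sum_const_zero _

theorem uniqueDiffOn_unitDisk : UniqueDiffOn ℝ (unitDisk m) :=
  uniqueDiffOn_convex (convex_closedBall _ _)
    ⟨0, Metric.ball_subset_interior_closedBall (Metric.mem_ball_self one_pos)⟩

theorem closure_interior_unitDisk : closure (interior (unitDisk m)) = unitDisk m := by
  rw [(convex_closedBall _ _).closure_interior_eq_closure_of_nonempty_interior
    ⟨0, Metric.ball_subset_interior_closedBall (Metric.mem_ball_self one_pos)⟩,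
    Metric.isClosed_closedBall.closure_eq]

end PartialDerivatives

section DiskGeometry

open Set Topology

section Diffeomorphisms

variable {E : Type*} [NormedAddCommGroup E] [NormedSpace ℝ E]

/-- The diffeomorphism `x ↦ x + h x • e`, for a smooth function `h` that is constant along the lines
of direction `e`. -/
def shearDiffeomorph (e : E) (h : E → ℝ) (hh : ContDiff ℝ ∞ h)
    (he : ∀ (x : E) (c : ℝ), h (x + c • e) = h x) : E ≃ₘ[ℝ] E where
  toFun x := x + h x • e
  invFun x := x + (-h x) • e
  left_inv x := by simp only [he]; simp
  right_inv x := by simp only [he]; simp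
  contMDiff_toFun := (contDiff_id.add (hh.smul contDiff_const)).contMDiff
  contMDiff_invFun := (contDiff_id.add (hh.neg.smul contDiff_const)).contMDiff

/-- The diffeomorphism `x ↦ x₀ + c • x`, which carries the unit disk to the disk of radius `c`
around `x₀`. -/
noncomputable def homothetyDiffeomorph (x₀ : E) {c : ℝ} (hc : c ≠ 0) : E ≃ₘ[ℝ] E where
  toFun x := x₀ + c • x
  invFun y := c⁻¹ • (y - x₀)
  left_inv x := by simp [smul_smul, hc]
  right_inv y := by simp [smul_smul, hc]
  contMDiff_toFun := (contDiff_const.add (contDiff_id.const_smul c)).contMDiff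
  contMDiff_invFun := ((contDiff_id.sub contDiff_const).const_smul c⁻¹).contMDiff

theorem image_diffeomorph_mem_nhdsWithin (Φ : E ≃ₘ[ℝ] E) {s t : Set E} {x : E} (h : s ∈ 𝓝[t] x) :
    Φ '' s ∈ 𝓝[Φ '' t] (Φ x) :=
  (Φ.toHomeomorph.isEmbedding.map_nhdsWithin_eq t x).symm ▸ Filter.image_mem_map h

theorem exists_diffeomorph_image_subset_of_cone {K A N : Set E} {x₀ : E}
    (hK : ∀ (c : ℝ) (x : E), 0 < c → (c • x ∈ K ↔ x ∈ K)) (hA : Bornology.IsBounded A)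
    (hAK : A ⊆ K) (hA₀ : A ∈ 𝓝[K] 0) (hN : N ∈ 𝓝[{x | x - x₀ ∈ K}] x₀) :
    ∃ Φ : E ≃ₘ[ℝ] E, Φ '' A ⊆ N ∧ Φ '' A ∈ 𝓝[{x | x - x₀ ∈ K}] x₀ := by
  obtain ⟨R, -, hAR⟩ := hA.exists_pos_norm_le
  obtain ⟨ε, hε, hεN⟩ := Metric.mem_nhdsWithin_iff.1 hN
  obtain ⟨c, hc, hcR⟩ := exists_pos_mul_lt hε R
  let Φ := homothetyDiffeomorph x₀ hc.ne'
  have hΦ (x : E) : Φ x = x₀ + c • x := rfl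
  have hΦK : Φ '' K = {x | x - x₀ ∈ K} := by
    rw [Φ.image_eq_preimage_symm]
    exact ext fun x => hK c⁻¹ (x - x₀) (inv_pos.2 hc)
  refine ⟨Φ, ?_, ?_⟩
  · rintro - ⟨x, hx, rfl⟩
    refine hεN ⟨?_, hΦK ▸ mem_image_of_mem Φ (hAK hx)⟩
    rw [hΦ, mem_ball_iff_norm, add_sub_cancel_left, norm_smul, Real.norm_of_nonneg hc.le]
    calc c * ‖x‖ ≤ c * R := by gcongr; exact hAR x hx
      _ = R * c := mul_comm c R
      _ < ε := hcR
  · have h := image_diffeomorph_mem_nhdsWithin Φ hA₀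
    rwa [hΦK, hΦ, smul_zero, add_zero] at h

end Diffeomorphisms

/-- A smooth function on `ℝ` that equals `t ↦ √(1 - t)` near `0` and dominates it on `[0, 1]`. -/
noncomputable def sqrtBump (t : ℝ) : ℝ := 1 - Real.smoothTransition (2 - 4 * t) * (1 - √(1 - t))

theorem contDiff_sqrtBump : ContDiff ℝ ∞ sqrtBump := by
  rw [contDiff_iff_contDiffAt]
  intro t
  rcases lt_or_ge t 1 with ht | ht
  · have hsqrt : ContDiffAt ℝ ∞ (fun t : ℝ => √(1 - t)) t :=
      (contDiffAt_const.sub contDiffAt_id).sqrt (sub_pos.2 ht).ne'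
    have hcutoff : ContDiff ℝ ∞ fun t : ℝ => Real.smoothTransition (2 - 4 * t) :=
      Real.smoothTransition.contDiff.comp (contDiff_const.sub (contDiff_const.mul contDiff_id))
    exact contDiffAt_const.sub (hcutoff.contDiffAt.mul (contDiffAt_const.sub hsqrt))
  · refine (contDiffAt_const (c := (1 : ℝ))).congr_of_eventuallyEq ?_
    filter_upwards [lt_mem_nhds (show (1 / 2 : ℝ) < t by linarith)] with y hy
    simp [sqrtBump, Real.smoothTransition.zero_of_nonpos (show 2 - 4 * y ≤ 0 by linarith)]

theorem sqrtBump_of_le {t : ℝ} (ht : t ≤ 1 / 4) : sqrtBump t = √(1 - t) := by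
  simp [sqrtBump, Real.smoothTransition.one_of_one_le (show 1 ≤ 2 - 4 * t by linarith)]

theorem sqrt_le_sqrtBump {t : ℝ} (ht : 0 ≤ t) : √(1 - t) ≤ sqrtBump t := by
  have hsqrt : √(1 - t) ≤ 1 := Real.sqrt_le_one.2 (by linarith)
  have := mul_nonneg (sub_nonneg.2 (Real.smoothTransition.le_one (2 - 4 * t))) (sub_nonneg.2 hsqrt)
  rw [sqrtBump]
  linarith

variable {m : ℕ}

/-- The square of the distance to the `i`-th coordinate axis. -/
noncomputable def axisDistSq (i : Fin m) (u : Euc m) : ℝ := ‖u‖ ^ 2 - u i ^ 2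

theorem contDiff_axisDistSq (i : Fin m) : ContDiff ℝ ∞ (axisDistSq i) :=
  (contDiff_norm_sq ℝ).sub ((EuclideanSpace.proj i : Euc m →L[ℝ] ℝ).contDiff.pow 2)

theorem axisDistSq_nonneg (i : Fin m) (u : Euc m) : 0 ≤ axisDistSq i u :=
  sub_nonneg.2 (sq_le_sq.2 (by simpa using PiLp.norm_apply_le u i))

theorem norm_add_smul_single_sq (i : Fin m) (u : Euc m) (c : ℝ) :
    ‖u + c • EuclideanSpace.single i (1 : ℝ)‖ ^ 2 = axisDistSq i u + (u i + c) ^ 2 := by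
  simp only [norm_add_sq_real, inner_smul_right, EuclideanSpace.inner_single_right, axisDistSq,
    norm_smul, PiLp.norm_single, norm_one, mul_one, one_mul, conj_trivial, Real.norm_eq_abs, sq_abs]
  ring

theorem axisDistSq_add_smul_single (i : Fin m) (u : Euc m) (c : ℝ) :
    axisDistSq i (u + c • EuclideanSpace.single i (1 : ℝ)) = axisDistSq i u := by
  rw [axisDistSq, norm_add_smul_single_sq]
  simp

/-- A shear along the `i`-th axis that lifts the lower hemisphere of the unit sphere to the upper
side of the hyperplane `{x | x i = 0}`, and to the hyperplane itself near the axis. -/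
noncomputable def flatCap (i : Fin m) : Euc m ≃ₘ[ℝ] Euc m :=
  shearDiffeomorph (EuclideanSpace.single i (1 : ℝ)) (sqrtBump ∘ axisDistSq i)
    (contDiff_sqrtBump.comp (contDiff_axisDistSq i)) fun u c =>
      congrArg sqrtBump (axisDistSq_add_smul_single i u c)

theorem flatCap_apply (i : Fin m) (u : Euc m) :
    flatCap i u = u + sqrtBump (axisDistSq i u) • EuclideanSpace.single i (1 : ℝ) := rfl

theorem flatCap_apply_nonneg (i : Fin m) {u : Euc m} (hu : u ∈ unitDisk m) :
    0 ≤ flatCap i u i := by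
  have hnorm : axisDistSq i u + u i ^ 2 ≤ 1 := by
    rw [axisDistSq, sub_add_cancel]
    exact pow_le_one₀ (norm_nonneg _) (mem_closedBall_zero_iff.1 hu)
  have hcoord : -√(1 - axisDistSq i u) ≤ u i :=
    (abs_le.1 (Real.abs_le_sqrt (by linarith))).1
  calc (0 : ℝ) ≤ u i + sqrtBump (axisDistSq i u) := by
        linarith [sqrt_le_sqrtBump (axisDistSq_nonneg i u)]
    _ = flatCap i u i := by simp [flatCap_apply]

theorem flatCap_symm_mem_unitDisk (i : Fin m) {y : Euc m} (hy₀ : 0 ≤ y i) (hy : ‖y‖ ≤ 1 / 2) :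
    (flatCap i).symm y ∈ unitDisk m := by
  have haxis := axisDistSq_nonneg i y
  have hnorm : axisDistSq i y + y i ^ 2 ≤ 1 / 4 := by
    rw [axisDistSq, sub_add_cancel]
    nlinarith [norm_nonneg y]
  have hyi : y i ≤ 1 / 2 := by nlinarith
  have hle : axisDistSq i y ≤ 1 / 4 := by nlinarith
  have hsqrt_sq := Real.sq_sqrt (show 0 ≤ 1 - axisDistSq i y by linarith)
  have hsqrt : 1 / 2 ≤ √(1 - axisDistSq i y) := Real.le_sqrt_of_sq_le (by linarith)
  rw [mem_closedBall_zero_iff, ← sq_le_one_iff₀ (norm_nonneg _)]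
  calc ‖(flatCap i).symm y‖ ^ 2
      = axisDistSq i y + (y i + -√(1 - axisDistSq i y)) ^ 2 := by
        rw [← sqrtBump_of_le hle, ← norm_add_smul_single_sq]
        rfl
    _ ≤ 1 := by nlinarith

theorem flatCap_image_mem_nhdsWithin (i : Fin m) :
    flatCap i '' unitDisk m ∈ 𝓝[{x | 0 ≤ x i}] 0 := by
  rw [(flatCap i).image_eq_preimage_symm]
  filter_upwards [self_mem_nhdsWithin,
    mem_nhdsWithin_of_mem_nhds (Metric.closedBall_mem_nhds (0 : Euc m) one_half_pos)] with y hy₀ hy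
  exact flatCap_symm_mem_unitDisk i hy₀ (mem_closedBall_zero_iff.1 hy)

theorem exists_diffeomorph_image_unitDisk_subset {X : Set (Euc m)}
    (hX : X = univ ∨ ∃ i : Fin m, X = {x | 0 ≤ x i}) {x₀ : Euc m} (hx₀ : x₀ ∈ X) {N : Set (Euc m)}
    (hN : N ∈ 𝓝[X] x₀) :
    ∃ Φ : Euc m ≃ₘ[ℝ] Euc m, Φ '' unitDisk m ⊆ N ∧ Φ '' unitDisk m ∈ 𝓝[X] x₀ := by
  have hinterior (hX₀ : X ∈ 𝓝 x₀) :
      ∃ Φ : Euc m ≃ₘ[ℝ] Euc m, Φ '' unitDisk m ⊆ N ∧ Φ '' unitDisk m ∈ 𝓝[X] x₀ := by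
    have hX' : 𝓝[X] x₀ = 𝓝[{x | x - x₀ ∈ univ}] x₀ := by
      simp [nhdsWithin_eq_nhds.2 hX₀]
    rw [hX'] at hN ⊢
    exact exists_diffeomorph_image_subset_of_cone (fun _ _ _ => Iff.rfl)
      Metric.isBounded_closedBall (subset_univ _)
      (mem_nhdsWithin_of_mem_nhds (Metric.closedBall_mem_nhds 0 one_pos)) hN
  rcases hX with rfl | ⟨i, rfl⟩
  · exact hinterior Filter.univ_mem
  rcases (show 0 ≤ x₀ i from hx₀).eq_or_lt with h₀ | h₀
  · have hX' : {x : Euc m | 0 ≤ x i} = {x | x - x₀ ∈ {x : Euc m | 0 ≤ x i}} := by simp [← h₀]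
    rw [hX'] at hN ⊢
    obtain ⟨Φ, hΦN, hΦ⟩ := exists_diffeomorph_image_subset_of_cone
      (K := {x : Euc m | 0 ≤ x i}) (A := flatCap i '' unitDisk m) (fun c x hc => by simp [hc])
      ((isCompact_closedBall (0 : Euc m) 1).image (flatCap i).continuous).isBounded
      (image_subset_iff.2 fun u hu => flatCap_apply_nonneg i hu)
      (flatCap_image_mem_nhdsWithin i) hN
    refine ⟨(flatCap i).trans Φ, ?_⟩
    rw [Diffeomorph.coe_trans, image_comp]
    exact ⟨hΦN, hΦ⟩
  · exact hinterior (((EuclideanSpace.proj i : Euc m →L[ℝ] ℝ).continuous.continuousAt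
      (x := x₀)).eventually_const_le h₀)

end DiskGeometry

section DiskCharts

open Set Topology

theorem isEmbedding_of_comp_of_mapsTo {X Y Z : Type*} [TopologicalSpace X] [TopologicalSpace Y]
    [TopologicalSpace Z] {f : X → Y} {V : Set Y} {g : Y → Z} (hf : Continuous f)
    (hfV : ∀ x, f x ∈ V) (hg : ContinuousOn g V) (hgf : IsEmbedding (g ∘ f)) : IsEmbedding f :=
  IsEmbedding.subtypeVal.comp (IsEmbedding.of_comp (hf.subtype_mk hfV)
    (continuousOn_iff_continuous_domRestrict.1 hg) hgf)

variable {m : ℕ} {H : Type*} [TopologicalSpace H] {I : ModelWithCorners ℝ (Euc m) H}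
  {M : Type*} [TopologicalSpace M] [ChartedSpace H M]

theorem injective_mfderivWithin_of_leftInverse {Q : Euc m → M} {R : M → Euc m} {D : Set (Euc m)}
    {u : Euc m} (hD : UniqueDiffWithinAt ℝ D u) (hu : u ∈ D)
    (hQ : MDifferentiableWithinAt 𝓘(ℝ, Euc m) I Q D u)
    (hR : MDifferentiableAt I 𝓘(ℝ, Euc m) R (Q u)) (hRQ : ∀ u ∈ D, R (Q u) = u) :
    Function.Injective (mfderivWithin 𝓘(ℝ, Euc m) I Q D u) := by
  let R' : TangentSpace I (Q u) →L[ℝ] Euc m := mfderiv I 𝓘(ℝ, Euc m) R (Q u)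
  let Q' : Euc m →L[ℝ] TangentSpace I (Q u) := mfderivWithin 𝓘(ℝ, Euc m) I Q D u
  have hcomp : HasFDerivWithinAt (R ∘ Q) (R' ∘L Q') D u :=
    (hR.hasMFDerivAt.comp_hasMFDerivWithinAt u hQ.hasMFDerivWithinAt).hasFDerivWithinAt
  have hid : HasFDerivWithinAt (R ∘ Q) (ContinuousLinearMap.id ℝ (Euc m)) D u :=
    (hasFDerivWithinAt_id u D).congr hRQ (hRQ u hu)
  exact Function.LeftInverse.injective (g := R') fun a =>
    congrArg (fun L : Euc m →L[ℝ] Euc m => L a) (hD.eq hcomp hid)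

theorem IsEmbeddingOn.of_leftInverse {Q : Euc m → M} {R : M → Euc m} {D : Set (Euc m)} {V : Set M}
    (hD : UniqueDiffOn ℝ D) (hQ : ContMDiffOn 𝓘(ℝ, Euc m) I ∞ Q D) (hV : IsOpen V)
    (hR : ContMDiffOn I 𝓘(ℝ, Euc m) ∞ R V) (hQV : MapsTo Q D V) (hRQ : ∀ u ∈ D, R (Q u) = u) :
    IsEmbeddingOn I Q D where
  contMDiffOn := hQ
  injective_mfderivWithin u hu :=
    injective_mfderivWithin_of_leftInverse (hD u hu) hu
      ((hQ u hu).mdifferentiableWithinAt (by simp))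
      ((hR.contMDiffAt (hV.mem_nhds (hQV hu))).mdifferentiableAt (by simp)) hRQ
  isEmbedding := by
    have hid : R ∘ D.domRestrict Q = Subtype.val := funext fun u => hRQ u u.2
    exact isEmbedding_of_comp_of_mapsTo (continuousOn_iff_continuous_domRestrict.1 hQ.continuousOn)
      (fun u => hQV u.2) hR.continuousOn (hid ▸ IsEmbedding.subtypeVal)

theorem exists_diskChart [IsManifold I ∞ M] (hI : IsBoundaryModel I) (p : M) :
    ∃ (Q : Euc m → M) (R : M → Euc m) (V : Set M), IsEmbeddingOn I Q (unitDisk m) ∧ V ∈ 𝓝 p ∧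
      ContMDiffOn I 𝓘(ℝ, Euc m) ∞ R V ∧ ∀ z ∈ V, R z ∈ unitDisk m ∧ Q (R z) = z := by
  let e := extChartAt I p
  obtain ⟨Φ, hΦN, hΦ⟩ := exists_diffeomorph_image_unitDisk_subset hI
    (mem_range_self (chartAt H p p) : e p ∈ range I) (extChartAt_target_mem_nhdsWithin p)
  have hΦN : MapsTo Φ (unitDisk m) e.target := image_subset_iff.1 hΦN
  have hQ : ContMDiffOn 𝓘(ℝ, Euc m) I ∞ (e.symm ∘ Φ) (unitDisk m) :=
    (contMDiffOn_extChartAt_symm p).comp Φ.contMDiff.contMDiffOn hΦN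
  have hR : ContMDiffOn I 𝓘(ℝ, Euc m) ∞ (Φ.symm ∘ e) e.source :=
    Φ.symm.contMDiff.comp_contMDiffOn (by rw [extChartAt_source]; exact contMDiffOn_extChartAt)
  have hV : e ⁻¹' (Φ '' unitDisk m) ∈ 𝓝 p := by rwa [← Filter.mem_map, map_extChartAt_nhds]
  refine ⟨e.symm ∘ Φ, Φ.symm ∘ e, e.source ∩ e ⁻¹' (Φ '' unitDisk m), ?_,
    Filter.inter_mem (extChartAt_source_mem_nhds p) hV, hR.mono inter_subset_left, ?_⟩
  · refine .of_leftInverse uniqueDiffOn_unitDisk hQ (isOpen_extChartAt_source p) hR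
      (fun u hu => e.map_target (hΦN hu)) fun u hu => ?_
    simp only [Function.comp_apply, e.right_inv (hΦN hu), Φ.symm_apply_apply]
  · rintro z ⟨hz, u, hu, hΦu⟩
    simp only [Function.comp_apply, ← hΦu, Φ.symm_apply_apply]
    exact ⟨hu, hΦu ▸ e.left_inv hz⟩

end DiskCharts

section CompositionEstimate

variable {E F G : Type*} [NormedAddCommGroup E] [NormedSpace ℝ E] [NormedAddCommGroup F]
  [NormedSpace ℝ F] [NormedAddCommGroup G] [NormedSpace ℝ G]

theorem iteratedFDerivWithin_interior (n : ℕ) (g : E → F) {D : Set E} {x : E}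
    (hx : x ∈ interior D) :
    iteratedFDerivWithin ℝ n g (interior D) x = iteratedFDerivWithin ℝ n g D x :=
  iteratedFDerivWithin_congr_set ((Filter.eventuallyEq_univ.2 (isOpen_interior.mem_nhds hx)).trans
    (Filter.eventuallyEq_univ.2 (mem_interior_iff_mem_nhds.1 hx)).symm) n

theorem exists_forall_norm_iteratedFDerivWithin_le {h : E → F} {D : Set E} {s : ℕ}
    (hD : IsCompact D) (hh : ContDiffOn ℝ s h D) :
    ∃ B : ℝ, ∀ n ≤ s, ∀ x ∈ interior D, ‖iteratedFDerivWithin ℝ n h D x‖ ≤ B := by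
  choose! C hC using fun n (hn : n ≤ s) => exists_bound_iteratedFDerivWithin hD hh hn
  obtain ⟨B, hB⟩ := ((Set.finite_Iic s).image C).bddAbove
  exact ⟨B, fun n hn x hx => (hC n hn x hx).trans (hB (Set.mem_image_of_mem C hn))⟩

variable (G) in
theorem exists_forall_norm_iteratedFDerivWithin_comp_le {h : E → F} {D : Set E} {t : Set F} {s : ℕ}
    (hD : IsCompact D) (hh : ContDiffOn ℝ s h D) (hht : Set.MapsTo h D t)
    (ht : UniqueDiffOn ℝ t) :
    ∃ C : ℝ, 0 ≤ C ∧ ∀ g : F → G, ContDiffOn ℝ s g t → ∀ A : ℝ,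
      (∀ n ≤ s, ∀ y ∈ t, ‖iteratedFDerivWithin ℝ n g t y‖ ≤ A) →
        ∀ n ≤ s, ∀ x ∈ interior D, ‖iteratedFDerivWithin ℝ n (g ∘ h) D x‖ ≤ C * A := by
  obtain ⟨B, hB⟩ := exists_forall_norm_iteratedFDerivWithin_le hD hh
  refine ⟨s.factorial * (max 1 B) ^ s, by positivity, fun g hg A hA n hn x hx => ?_⟩
  have hA₀ : 0 ≤ A := (norm_nonneg _).trans (hA n hn (h x) (hht (interior_subset hx)))
  have hhx (i : ℕ) (hi : 1 ≤ i) (hin : i ≤ n) :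
      ‖iteratedFDerivWithin ℝ i h (interior D) x‖ ≤ (max 1 B) ^ i :=
    calc ‖iteratedFDerivWithin ℝ i h (interior D) x‖ ≤ B := by
          rw [iteratedFDerivWithin_interior i h hx]
          exact hB i (hin.trans hn) x hx
      _ ≤ max 1 B := le_max_right 1 B
      _ ≤ (max 1 B) ^ i := le_self_pow₀ (le_max_left 1 B) (Nat.one_le_iff_ne_zero.1 hi)
  calc ‖iteratedFDerivWithin ℝ n (g ∘ h) D x‖
      = ‖iteratedFDerivWithin ℝ n (g ∘ h) (interior D) x‖ := by
        rw [iteratedFDerivWithin_interior n _ hx]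
    _ ≤ n.factorial * A * (max 1 B) ^ n :=
        norm_iteratedFDerivWithin_comp_le hg (hh.mono interior_subset) (by exact_mod_cast hn) ht
          isOpen_interior.uniqueDiffOn (hht.mono_left interior_subset) hx
          (fun i hi => hA i (hi.trans hn) _ (hht (interior_subset hx))) hhx
    _ ≤ s.factorial * A * (max 1 B) ^ s := by
        gcongr
        exact le_max_left 1 B
    _ = s.factorial * (max 1 B) ^ s * A := by ring

end CompositionEstimate

section WeakTopology

open Topology

variable {m : ℕ} {H : Type*} [TopologicalSpace H] {I : ModelWithCorners ℝ (Euc m) H}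
  {M : Type*} [TopologicalSpace M] [ChartedSpace H M] {r : ℕ∞} {k : ℕ}

instance : IsTopologicalAddGroup (CrMap I M r k) :=
  topologicalAddGroup_iInf fun _ => topologicalAddGroup_iInf fun _ => inferInstance

theorem withSeminorms_weakSeminorm :
    WithSeminorms fun a : CompactEmbedding I M × {s : ℕ // (s : ℕ∞) ≤ r} =>
      weakSeminorm (k := k) a.1 a.2.1 a.2.2 := by
  rw [SeminormFamily.withSeminorms_iff_topologicalSpace_eq_iInf, iInf_prod]
  rfl

theorem norm_partialDerivOn_le_weakSeminorm (P : CompactEmbedding I M) {s : ℕ}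
    (hs : (s : ℕ∞) ≤ r) (f : CrMap I M r k) {α : Fin m → ℕ} (hα : ∑ i, α i ≤ s) {x : Euc m}
    (hx : x ∈ interior P.domain) :
    ‖partialDerivOn α (f ∘ P.toFun) P.domain x‖ ≤ weakSeminorm P s hs f :=
  le_ciSup (P.bddAbove hs f) (⟨⟨α, hα⟩, ⟨x, hx⟩⟩ : P.Range s)

theorem weakSeminorm_le (P : CompactEmbedding I M) {s : ℕ} (hs : (s : ℕ∞) ≤ r)
    (f : CrMap I M r k) {C : ℝ} (hC : 0 ≤ C) (h : ∀ α : Fin m → ℕ, ∑ i, α i ≤ s →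
      ∀ x ∈ interior P.domain, ‖partialDerivOn α (f ∘ P.toFun) P.domain x‖ ≤ C) :
    weakSeminorm P s hs f ≤ C :=
  Real.iSup_le (fun a => h a.1.1 a.1.2 a.2 a.2.2) hC

variable (I M) in
/-- A smooth embedding in `M` of the closed unit disk. As in `IsEmbeddingOn`, the values of `toFun`
outside the disk are irrelevant. -/
structure DiskEmbedding where
  toFun : Euc m → M
  isEmbeddingOn : IsEmbeddingOn I toFun (unitDisk m)

namespace DiskEmbedding

/-- An embedding of the disk, regarded as an embedding of a compact subset of `ℝᵐ`. -/
def toCompactEmbedding (Q : DiskEmbedding I M) : CompactEmbedding I M :=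
  ⟨unitDisk m, Q.toFun, isCompact_closedBall _ _, Q.isEmbeddingOn⟩

theorem contDiffOn_comp (Q : DiskEmbedding I M) (f : CrMap I M r k) {n : ℕ} (hn : (n : ℕ∞) ≤ r) :
    ContDiffOn ℝ n (f ∘ Q.toFun) (unitDisk m) :=
  (Q.toCompactEmbedding.contDiffOn_comp f).of_le (by exact_mod_cast hn)

theorem norm_iteratedFDerivWithin_le (Q : DiskEmbedding I M) {s n : ℕ} (hs : (s : ℕ∞) ≤ r)
    (hn : n ≤ s) (f : CrMap I M r k) {x : Euc m} (hx : x ∈ unitDisk m) :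
    ‖iteratedFDerivWithin ℝ n (f ∘ Q.toFun) (unitDisk m) x‖ ≤
      m ^ n * weakSeminorm Q.toCompactEmbedding s hs f :=
  norm_iteratedFDerivWithin_le_of_closure_interior closure_interior_unitDisk uniqueDiffOn_unitDisk
    (Q.contDiffOn_comp f ((Nat.cast_le.2 hn).trans hs))
    (fun _ hα _ hy => norm_partialDerivOn_le_weakSeminorm Q.toCompactEmbedding hs f
      (hα.trans_le hn) hy) hx

end DiskEmbedding

namespace CompactEmbedding

theorem exists_norm_partialDerivOn_le_of_comp_eq (P : CompactEmbedding I M) (Q : DiskEmbedding I M)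
    {D : Set (Euc m)} (hD : IsCompact D) (hDP : D ⊆ P.domain) {h : Euc m → Euc m} {s : ℕ}
    (hs : (s : ℕ∞) ≤ r) (hh : ContDiffOn ℝ s h D) (hhD : Set.MapsTo h D (unitDisk m))
    (hQh : Set.EqOn (Q.toFun ∘ h) P.toFun D) :
    ∃ C : ℝ, 0 ≤ C ∧ ∀ (f : CrMap I M r k) (α : Fin m → ℕ), ∑ i, α i ≤ s → ∀ y ∈ interior D,
      ‖partialDerivOn α (f ∘ P.toFun) P.domain y‖ ≤
        C * weakSeminorm Q.toCompactEmbedding s hs f := by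
  obtain ⟨C, hC₀, hC⟩ :=
    exists_forall_norm_iteratedFDerivWithin_comp_le (Euc k) hD hh hhD uniqueDiffOn_unitDisk
  refine ⟨C * max 1 (m : ℝ) ^ s, by positivity, fun f α hα y hy => ?_⟩
  have hfQ (n : ℕ) (hn : n ≤ s) (z : Euc m) (hz : z ∈ unitDisk m) :
      ‖iteratedFDerivWithin ℝ n (f ∘ Q.toFun) (unitDisk m) z‖ ≤
        max 1 (m : ℝ) ^ s * weakSeminorm Q.toCompactEmbedding s hs f := by
    refine (Q.norm_iteratedFDerivWithin_le hs hn f hz).trans ?_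
    gcongr
    calc (m : ℝ) ^ n ≤ max 1 (m : ℝ) ^ n := by gcongr; exact le_max_right _ _
      _ ≤ max 1 (m : ℝ) ^ s := pow_le_pow_right₀ (le_max_left _ _) hn
  have hPD : P.domain =ᶠ[𝓝 y] D :=
    (Filter.eventuallyEq_univ.2 (Filter.mem_of_superset (mem_interior_iff_mem_nhds.1 hy) hDP)).trans
      (Filter.eventuallyEq_univ.2 (mem_interior_iff_mem_nhds.1 hy)).symm
  have hfP : Set.EqOn (f ∘ P.toFun) ((f ∘ Q.toFun) ∘ h) D := fun z hz => congrArg f (hQh hz).symm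
  calc ‖partialDerivOn α (f ∘ P.toFun) P.domain y‖
      ≤ ‖iteratedFDerivWithin ℝ (∑ i, α i) (f ∘ P.toFun) P.domain y‖ :=
        norm_partialDerivOn_le _ _ _ _
    _ = ‖iteratedFDerivWithin ℝ (∑ i, α i) ((f ∘ Q.toFun) ∘ h) D y‖ := by
        rw [iteratedFDerivWithin_congr_set hPD,
          iteratedFDerivWithin_congr hfP (interior_subset hy)]
    _ ≤ C * (max 1 (m : ℝ) ^ s * weakSeminorm Q.toCompactEmbedding s hs f) :=
        hC _ (Q.contDiffOn_comp f hs) _ hfQ _ hα y hy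
    _ = C * max 1 (m : ℝ) ^ s * weakSeminorm Q.toCompactEmbedding s hs f := (mul_assoc _ _ _).symm

theorem exists_local_norm_partialDerivOn_le [IsManifold I ∞ M] (hI : IsBoundaryModel I)
    (P : CompactEmbedding I M) {s : ℕ} (hs : (s : ℕ∞) ≤ r) {x : Euc m} (hx : x ∈ P.domain) :
    ∃ W ∈ 𝓝 x, ∃ (Q : DiskEmbedding I M) (C : ℝ), 0 ≤ C ∧
      ∀ (f : CrMap I M r k) (α : Fin m → ℕ), ∑ i, α i ≤ s → ∀ y ∈ W ∩ interior P.domain,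
        ‖partialDerivOn α (f ∘ P.toFun) P.domain y‖ ≤
          C * weakSeminorm Q.toCompactEmbedding s hs f := by
  obtain ⟨Q, R, V, hQ, hV, hR, hRQ⟩ := exists_diskChart hI (P.toFun x)
  have hPV : P.toFun ⁻¹' V ∈ 𝓝[P.domain] x :=
    (P.isEmbeddingOn.contMDiffOn.continuousOn x hx).preimage_mem_nhdsWithin'
      (nhdsWithin_le_nhds hV)
  obtain ⟨ε, hε, hεV⟩ := (nhdsWithin_hasBasis Metric.nhds_basis_closedBall _).mem_iff.1 hPV
  have hRP : ContDiffOn ℝ s (R ∘ P.toFun) (Metric.closedBall x ε ∩ P.domain) :=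
    contMDiffOn_iff_contDiffOn.1 <|
      (hR.comp (P.isEmbeddingOn.contMDiffOn.mono Set.inter_subset_right) hεV).of_le
        (by exact_mod_cast (le_top : (s : ℕ∞) ≤ ⊤))
  obtain ⟨C, hC₀, hC⟩ := P.exists_norm_partialDerivOn_le_of_comp_eq (k := k) ⟨Q, hQ⟩
    (P.isCompact_domain.inter_left Metric.isClosed_closedBall) Set.inter_subset_right hs hRP
    (fun y hy => (hRQ _ (hεV hy)).1) fun y hy => (hRQ _ (hεV hy)).2
  refine ⟨interior (Metric.closedBall x ε), interior_mem_nhds.2 (Metric.closedBall_mem_nhds x hε),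
    ⟨Q, hQ⟩, C, hC₀, fun f α hα y hy => hC f α hα y ?_⟩
  rwa [interior_inter]

theorem exists_weakSeminorm_le_sup [IsManifold I ∞ M] (hI : IsBoundaryModel I)
    (P : CompactEmbedding I M) {s : ℕ} (hs : (s : ℕ∞) ≤ r) :
    ∃ (L : Finset (DiskEmbedding I M)) (C : ℝ), ∀ f : CrMap I M r k,
      weakSeminorm P s hs f ≤ C * L.sup (fun Q => weakSeminorm Q.toCompactEmbedding s hs) f := by
  classical
  choose W hW Q C hC₀ hC using fun x : P.domain =>
    P.exists_local_norm_partialDerivOn_le (k := k) hI hs x.2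
  obtain ⟨t, ht⟩ := P.isCompact_domain.elim_nhds_subcover' (fun x hx => W ⟨x, hx⟩)
    fun x hx => hW ⟨x, hx⟩
  refine ⟨t.image Q, ∑ x ∈ t, C x, fun f => weakSeminorm_le P hs f
    (mul_nonneg (Finset.sum_nonneg fun x _ => hC₀ x) (apply_nonneg _ _)) fun α hα y hy => ?_⟩
  obtain ⟨x, hxt, hyx⟩ := Set.mem_iUnion₂.1 (ht (interior_subset hy))
  calc ‖partialDerivOn α (f ∘ P.toFun) P.domain y‖
      ≤ C x * weakSeminorm (Q x).toCompactEmbedding s hs f := hC x f α hα y ⟨hyx, hy⟩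
    _ ≤ (∑ x ∈ t, C x) *
          (t.image Q).sup (fun Q => weakSeminorm Q.toCompactEmbedding s hs) f := by
      gcongr
      · exact Finset.sum_nonneg fun x _ => hC₀ x
      · exact Finset.single_le_sum (fun x _ => hC₀ x) hxt
      · exact Seminorm.le_finset_sup_apply
          (p := fun Q : DiskEmbedding I M => weakSeminorm (k := k) Q.toCompactEmbedding s hs)
          (Finset.mem_image_of_mem Q hxt)

end CompactEmbedding

theorem withSeminorms_weakSeminorm_disk [IsManifold I ∞ M] (hI : IsBoundaryModel I) :
    WithSeminorms fun a : DiskEmbedding I M × {s : ℕ // (s : ℕ∞) ≤ r} =>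
      weakSeminorm (k := k) a.1.toCompactEmbedding a.2.1 a.2.2 := by
  classical
  refine withSeminorms_weakSeminorm.congr (.of_real fun a => ?_) (.of_real fun a => ?_)
  · refine ⟨{(a.1.toCompactEmbedding, a.2)}, 1, fun f => ?_⟩
    simp
  · obtain ⟨L, C, h⟩ := a.1.exists_weakSeminorm_le_sup (k := k) hI a.2.2
    refine ⟨L.image fun Q => (Q, a.2), C, fun f => ?_⟩
    rw [Finset.sup_image]
    exact h f

namespace DiskEmbedding

/-- The operator `f ↦ ∂_α (fʲ ∘ Q)` on `𝒞ʳ(M, ℝᵏ)`, with values in the continuous functions on the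
disk. At the boundary of the disk the derivatives are those up to the boundary. -/
noncomputable def partialDeriv (Q : DiskEmbedding I M) {α : Fin m → ℕ}
    (hα : ((∑ i, α i : ℕ) : ℕ∞) ≤ r) (j : Fin k) : CrMap I M r k →ₗ[ℝ] C(unitDisk m, ℝ) :=
  have hf (f : CrMap I M r k) :
      ContDiffOn ℝ (∑ i, α i : ℕ) (fun x => f (Q.toFun x) j) (unitDisk m) :=
    (EuclideanSpace.proj j : Euc k →L[ℝ] ℝ).contDiff.comp_contDiffOn (Q.contDiffOn_comp f hα)
  { toFun f := ⟨fun u => partialDerivOn α (fun x => f (Q.toFun x) j) (unitDisk m) u,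
      (continuousOn_partialDerivOn uniqueDiffOn_unitDisk (hf f)).domRestrict⟩
    map_add' f g := ContinuousMap.ext fun u =>
      partialDerivOn_add uniqueDiffOn_unitDisk (hf f) (hf g) u.2
    map_smul' c f := ContinuousMap.ext fun u =>
      partialDerivOn_const_smul c uniqueDiffOn_unitDisk (hf f) u.2 }

theorem partialDeriv_apply (Q : DiskEmbedding I M) {α : Fin m → ℕ}
    (hα : ((∑ i, α i : ℕ) : ℕ∞) ≤ r) (j : Fin k) (f : CrMap I M r k) (u : unitDisk m) :
    Q.partialDeriv hα j f u = partialDerivOn α (f ∘ Q.toFun) (unitDisk m) u j :=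
  partialDerivOn_comp_left (EuclideanSpace.proj j : Euc k →L[ℝ] ℝ) uniqueDiffOn_unitDisk
    (Q.contDiffOn_comp f hα) u.2

theorem norm_partialDeriv_le (Q : DiskEmbedding I M) {α : Fin m → ℕ}
    (hα : ((∑ i, α i : ℕ) : ℕ∞) ≤ r) (j : Fin k) (f : CrMap I M r k) :
    ‖Q.partialDeriv hα j f‖ ≤
      m ^ (∑ i, α i) * weakSeminorm Q.toCompactEmbedding (∑ i, α i) hα f := by
  refine (ContinuousMap.norm_le _ (by positivity)).2 fun u => ?_
  calc ‖Q.partialDeriv hα j f u‖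
      ≤ ‖partialDerivOn α (f ∘ Q.toFun) (unitDisk m) u‖ := by
        rw [partialDeriv_apply]
        exact PiLp.norm_apply_le _ j
    _ ≤ ‖iteratedFDerivWithin ℝ (∑ i, α i) (f ∘ Q.toFun) (unitDisk m) u‖ :=
        norm_partialDerivOn_le _ _ _ _
    _ ≤ m ^ (∑ i, α i) * weakSeminorm Q.toCompactEmbedding (∑ i, α i) hα f :=
        Q.norm_iteratedFDerivWithin_le hα le_rfl f u.2

theorem weakSeminorm_le_of_norm_partialDeriv_le (Q : DiskEmbedding I M) {s : ℕ}
    (hs : (s : ℕ∞) ≤ r) (f : CrMap I M r k) {B : ℝ} (hB : 0 ≤ B)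
    (h : ∀ (α : Fin m → ℕ) (hα : ∑ i, α i ≤ s) (j : Fin k),
      ‖Q.partialDeriv ((Nat.cast_le.2 hα).trans hs) j f‖ ≤ B) :
    weakSeminorm Q.toCompactEmbedding s hs f ≤ √k * B := by
  refine weakSeminorm_le _ hs f (by positivity) fun α hα x hx => ?_
  have hcoord (j : Fin k) : ‖partialDerivOn α (f ∘ Q.toFun) (unitDisk m) x j‖ ≤ B := by
    rw [← Q.partialDeriv_apply ((Nat.cast_le.2 hα).trans hs) j f ⟨x, interior_subset hx⟩]
    exact (ContinuousMap.norm_coe_le_norm _ _).trans (h α hα j)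
  refine ((EuclideanSpace.basisFun (Fin k) ℝ).norm_le_card_mul_iSup_norm_inner _).trans ?_
  rw [Fintype.card_fin]
  gcongr
  refine Real.iSup_le (fun j => ?_) hB
  rw [EuclideanSpace.basisFun_apply, EuclideanSpace.inner_single_left, map_one, one_mul]
  exact hcoord j

end DiskEmbedding

theorem finite_setOf_sum_le (s : ℕ) : {α : Fin m → ℕ | ∑ i, α i ≤ s}.Finite :=
  (Set.finite_Iic fun _ : Fin m => s).subset fun _ hα i =>
    (Finset.single_le_sum (fun _ _ => Nat.zero_le _) (Finset.mem_univ i)).trans hα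

theorem withSeminorms_norm_partialDeriv [IsManifold I ∞ M] (hI : IsBoundaryModel I) :
    WithSeminorms fun a :
        DiskEmbedding I M × {α : Fin m → ℕ // ((∑ i, α i : ℕ) : ℕ∞) ≤ r} × Fin k =>
      (normSeminorm ℝ C(unitDisk m, ℝ)).comp (a.1.partialDeriv a.2.1.2 a.2.2) := by
  classical
  refine (withSeminorms_weakSeminorm_disk hI).congr (.of_real ?_) (.of_real ?_)
  · rintro ⟨Q, ⟨α, hα⟩, j⟩
    refine ⟨{(Q, ⟨∑ i, α i, hα⟩)}, m ^ (∑ i, α i), fun f => ?_⟩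
    rw [Finset.sup_singleton]
    exact Q.norm_partialDeriv_le hα j f
  · rintro ⟨Q, s, hs⟩
    have : Fintype {α : Fin m → ℕ // ∑ i, α i ≤ s} := (finite_setOf_sum_le s).fintype
    let p (a : DiskEmbedding I M × {α : Fin m → ℕ // ((∑ i, α i : ℕ) : ℕ∞) ≤ r} × Fin k) :
        Seminorm ℝ (CrMap I M r k) :=
      (normSeminorm ℝ C(unitDisk m, ℝ)).comp (a.1.partialDeriv a.2.1.2 a.2.2)
    let e (a : {α : Fin m → ℕ // ∑ i, α i ≤ s} × Fin k) :
        DiskEmbedding I M × {α : Fin m → ℕ // ((∑ i, α i : ℕ) : ℕ∞) ≤ r} × Fin k :=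
      (Q, ⟨a.1.1, (Nat.cast_le.2 a.1.2).trans hs⟩, a.2)
    refine ⟨Finset.univ.image e, √k, fun f => ?_⟩
    have hle (a : {α : Fin m → ℕ // ∑ i, α i ≤ s} × Fin k) :
        p (e a) f ≤ (Finset.univ.image e).sup p f :=
      Seminorm.le_finset_sup_apply (Finset.mem_image_of_mem e (Finset.mem_univ a))
    refine Q.weakSeminorm_le_of_norm_partialDeriv_le hs f (apply_nonneg _ _) fun α hα j => ?_
    exact hle (⟨α, hα⟩, j)

end WeakTopology

section LocalFunctionals

variable {m : ℕ} {H : Type*} [TopologicalSpace H] {I : ModelWithCorners ℝ (Euc m) H}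
  {M : Type*} [TopologicalSpace M] [ChartedSpace H M] {r : ℕ∞} {k : ℕ}

theorem DiskEmbedding.continuous_partialDeriv (Q : DiskEmbedding I M) {α : Fin m → ℕ}
    (hα : ((∑ i, α i : ℕ) : ℕ∞) ≤ r) (j : Fin k) :
    Continuous (Q.partialDeriv (k := k) hα j) :=
  WithSeminorms.continuous_of_isBounded withSeminorms_weakSeminorm (norm_withSeminorms ℝ _) _ <|
    .of_real fun _ => ⟨{(Q.toCompactEmbedding, ⟨∑ i, α i, hα⟩)}, m ^ (∑ i, α i), fun f => by
      rw [Finset.sup_singleton]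
      exact Q.norm_partialDeriv_le hα j f⟩

theorem DiskEmbedding.exists_mem_localFunctionals (Q : DiskEmbedding I M) {α : Fin m → ℕ}
    (hα : ((∑ i, α i : ℕ) : ℕ∞) ≤ r) (j : Fin k) (l : C(unitDisk m, ℝ) →L[ℝ] ℝ) :
    ∃ S ∈ localFunctionals I M r k, ∀ f, S f = l (Q.partialDeriv hα j f) := by
  obtain ⟨μ, hμ⟩ := exists_signedMeasure_integral_eq l
  exact ⟨l.comp ⟨Q.partialDeriv hα j, Q.continuous_partialDeriv hα j⟩,
    ⟨Q.toFun, α, j, μ, Q.isEmbeddingOn, hα, fun f => hμ _⟩, fun f => rfl⟩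

theorem span_localFunctionals_eq_top [IsManifold I ∞ M] (hI : IsBoundaryModel I) :
    Submodule.span ℝ (localFunctionals I M r k) = ⊤ := by
  refine Submodule.eq_top_iff'.2 fun T => ?_
  obtain ⟨A, l, hl⟩ := exists_eq_sum_comp_of_withSeminorms (withSeminorms_norm_partialDeriv hI) T
  choose S hS hSl using fun a : A =>
    a.1.1.exists_mem_localFunctionals a.1.2.1.2 a.1.2.2 (l a)
  have hT : T = ∑ a, S a := ContinuousLinearMap.ext fun f =>
    calc T f = ∑ a, l a (a.1.1.partialDeriv a.1.2.1.2 a.1.2.2 f) := hl f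
      _ = ∑ a, S a f := Finset.sum_congr rfl fun a _ => (hSl a f).symm
      _ = (∑ a, S a) f := (map_sum (WeakBilin.eval (topDualPairing ℝ (CrMap I M r k)) f) S _).symm
  exact hT ▸ Submodule.sum_mem _ fun a _ => Submodule.subset_span (hS a)

theorem exists_pointEvaluation [IsManifold I ∞ M] (hI : IsBoundaryModel I) (p : M) (j : Fin k) :
    ∃ δ : CrDual I M r k, ∀ f : CrMap I M r k, δ f = f p j := by
  obtain ⟨Q, R, V, hQ, hV, -, hRQ⟩ := exists_diskChart hI p
  obtain ⟨hRp, hQR⟩ := hRQ p (mem_of_mem_nhds hV)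
  obtain ⟨δ, -, hδ⟩ := DiskEmbedding.exists_mem_localFunctionals (r := r) ⟨Q, hQ⟩ (α := 0)
    (by simp) j (ContinuousMap.evalCLM ℝ ⟨R p, hRp⟩)
  refine ⟨δ, fun f => ?_⟩
  rw [hδ, ContinuousMap.evalCLM_apply, DiskEmbedding.partialDeriv_apply, partialDerivOn_zero]
  exact congrArg (fun q => f q j) hQR

theorem closure_span_pointEvaluations_eq_univ [IsManifold I ∞ M] (hI : IsBoundaryModel I) :
    closure (Submodule.span ℝ (pointEvaluations I M r k) : Set (CrDual I M r k)) = Set.univ := by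
  refine closure_span_eq_univ_of_separating fun f hf => ?_
  ext p j
  obtain ⟨δ, hδ⟩ := exists_pointEvaluation (r := r) hI p j
  exact (hδ f).symm.trans (hf δ ⟨p, j, hδ⟩)

end LocalFunctionals

theorem mainTheorem12_general {m : ℕ} {H : Type*} [TopologicalSpace H]
    (I : ModelWithCorners ℝ (Euc m) H) (hI : IsBoundaryModel I)
    (M : Type*) [TopologicalSpace M] [ChartedSpace H M] [IsManifold I ∞ M] (r : ℕ∞) (k : ℕ) :
    Submodule.span ℝ (localFunctionals I M r k) = ⊤ ∧
    (∀ (p : M) (j : Fin k), ∃ δ : CrDual I M r k, ∀ f : CrMap I M r k, δ f = f p j) ∧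
    closure (Submodule.span ℝ (pointEvaluations I M r k) : Set (CrDual I M r k)) = Set.univ :=
  ⟨span_localFunctionals_eq_top hI, exists_pointEvaluation hI,
    closure_span_pointEvaluations_eq_univ hI⟩

theorem mainTheorem12 {m : ℕ} {H : Type*} [TopologicalSpace H]
    (I : ModelWithCorners ℝ (Euc m) H) (hI : IsBoundaryModel I)
    (M : Type*) [TopologicalSpace M] [ChartedSpace H M] [IsManifold I ∞ M]
    [T2Space M] [SecondCountableTopology M] (r : ℕ∞) (k : ℕ) :
    Submodule.span ℝ (localFunctionals I M r k) = ⊤ ∧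
    (∀ (p : M) (j : Fin k), ∃ δ : CrDual I M r k, ∀ f : CrMap I M r k, δ f = f p j) ∧
    closure (Submodule.span ℝ (pointEvaluations I M r k) : Set (CrDual I M r k)) = Set.univ :=
  mainTheorem12_general I hI M r k
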